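/- Let $H$ be a real separable Hilbert space and let $\mu$ be a Borel probability measure on $H$ with bounded support; write $\operatorname{diam}(\mu)$ for the diameter of $\operatorname{supp}(\mu)$. For $d\in\mathbb N$ let $$e_2(\mu,d)=\inf_{L}\Big(\int_H \operatorname{dist}^2(x,L)\,d\mu(x)\Big)^{1/2},$$ where the infimum is over all $d$-dimensional affine subspaces $L$ of $H$. For $X=(x_0,\dots,x_{d+1})\in H^{d+2}$ let $M_{d+1}(X)$ be the $(d+1)$-volume of the parallelotope generated by $x_1-x_0,\dots,x_{d+1}-x_0$, let $\operatorname{diam}(X)=\max_{i,j}\|x_i-x_j\|$, let $$\operatorname{p_d\sin}_{x_i}(X)=\frac{M_{d+1}(X)}{\prod_{0\le j\le d+1,\ j\ne i}\|x_j-x_i\|}$$ if the points $x_0,\dots,x_{d+1}$ are pairwise distinct and $\operatorname{p_d\sin}_{x_i}(X)=0$ otherwise, and define the polar geometric condition number $$c_{\mathrm{pol}}(X)=\operatorname{diam}(X)\,\sqrt{\frac{\sum_{i=0}^{d+1}\operatorname{p_d\sin}^2_{x_i}(X)}{d+2}}.$$ For $\gamma>0$, $\mu$ is called $\gamma$-regular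 with constant $C\ge 1$ if $$\frac{t^\gamma}{C}\le\mu(B(x,t))\le C\,t^\gamma\qquad\text{for all }x\in\operatorname{supp}(\mu),\ 0<t\le\operatorname{diam}(\mu),$$ where $B(x,t)$ is the closed ball, and $\gamma$-upper-regular with constant $C$ if the upper bound holds; the least such $C$ is the regularity constant of $\mu$. **Theorem.** Suppose that either $\mu$ is $\gamma$-upper-regular with constant $C$ for some $\gamma>2$, or $d=1$ and $\mu$ is $\gamma$-regular with constant $C$ for some $\gamma>1$. Then $c_{\mathrm{pol}}^2$ is $\mu^{d+2}$-integrable and $$\int_{H^{d+2}}c_{\mathrm{pol}}^2(X)\,d\mu^{d+2}(X)\le K\,e_2^2(\mu,d),$$ where the constant $K>0$ depends only on $d$, $\gamma$, $\operatorname{diam}(\mu)$ and $C$. -/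

import Mathlib

open MeasureTheory

noncomputable section

namespace GCN

/-- The set `AG_d(H)` of `d`-flats of `H`, i.e. of (nonempty) affine subspaces of dimension `d`. -/
def affineGrassmannian (d : ℕ) (H : Type*) [NormedAddCommGroup H] [InnerProductSpace ℝ H] :
    Set (AffineSubspace ℝ H) :=
  {L | (L : Set H).Nonempty ∧ FiniteDimensional ℝ L.direction ∧ Module.finrank ℝ L.direction = d}

/-- The `d`-dimensional least squares error
`e₂(μ, d) = inf_{L ∈ AG_d(H)} (∫ dist(x, L)² dμ(x))^{1/2}`. -/
def lsError {H : Type*} [NormedAddCommGroup H] [InnerProductSpace ℝ H] [MeasurableSpace H]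
    (μ : Measure H) (d : ℕ) : ℝ :=
  ⨅ L : affineGrassmannian d H, √(∫ x, Metric.infDist x (L.1 : Set H) ^ 2 ∂μ)

/-- `diam(μ)`, the diameter of the support of `μ`. -/
def measureDiam {H : Type*} [NormedAddCommGroup H] [MeasurableSpace H] (μ : Measure H) : ℝ :=
  Metric.diam μ.support

/-- `M_n(X)`, the `n`-volume of a parallelotope generated by the vertices of the `n`-simplex
`X = (x₀, …, x_n)`: the square root of the Gram determinant of `x₁ - x₀, …, x_n - x₀`
(it does not depend on which vertex serves as the origin). -/
def parVolume {H : Type*} [NormedAddCommGroup H] [InnerProductSpace ℝ H] {n : ℕ}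
    (X : Fin (n + 1) → H) : ℝ :=
  √(Matrix.gram ℝ (fun i : Fin n => X i.succ - X 0)).det

/-- `diam(X)`, the maximal edge length of the simplex `X`. -/
def simplexDiam {H : Type*} [NormedAddCommGroup H] {n : ℕ} (X : Fin n → H) : ℝ :=
  Metric.diam (Set.range X)

open Classical in
/-- The `d`-dimensional polar sine of the `(d+1)`-simplex `X` with respect to its vertex `x_i`.
The condition says that the minimal edge length of `X` is positive. -/
def polarSine {H : Type*} [NormedAddCommGroup H] [InnerProductSpace ℝ H] {d : ℕ}
    (X : Fin (d + 2) → H) (i : Fin (d + 2)) : ℝ :=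
  if ∀ j k : Fin (d + 2), j ≠ k → 0 < ‖X j - X k‖ then
    parVolume X / ∏ j ∈ Finset.univ.erase i, ‖X j - X i‖
  else 0

/-- The polar geometric condition number
`c_pol(X) = diam(X) ((∑_{i=0}^{d+1} psin_{x_i}(X)²) / (d + 2))^{1/2}`. -/
def cPol {H : Type*} [NormedAddCommGroup H] [InnerProductSpace ℝ H] {d : ℕ}
    (X : Fin (d + 2) → H) : ℝ :=
  simplexDiam X * √((∑ i, polarSine X i ^ 2) / ((d : ℝ) + 2))

/-- `μ` is `γ`-upper-regular and `C ≥ 1` is a constant for this: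
`μ(B(x,t)) ≤ C t^γ` for all `x ∈ supp(μ)` and `0 < t ≤ diam(μ)`.
The least such `C` is the regularity constant. -/
def IsUpperRegularWith {H : Type*} [NormedAddCommGroup H] [MeasurableSpace H]
    (μ : Measure H) (γ C : ℝ) : Prop :=
  1 ≤ C ∧ ∀ x ∈ μ.support, ∀ t : ℝ, 0 < t → t ≤ measureDiam μ →
    μ.real (Metric.closedBall x t) ≤ C * t ^ γ

/-- `μ` is `γ`-regular and `C ≥ 1` is a constant for this:
`t^γ / C ≤ μ(B(x,t)) ≤ C t^γ` for all `x ∈ supp(μ)` and `0 < t ≤ diam(μ)`.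
The least such `C` is the regularity constant. -/
def IsRegularWith {H : Type*} [NormedAddCommGroup H] [MeasurableSpace H]
    (μ : Measure H) (γ C : ℝ) : Prop :=
  1 ≤ C ∧ ∀ x ∈ μ.support, ∀ t : ℝ, 0 < t → t ≤ measureDiam μ →
    t ^ γ / C ≤ μ.real (Metric.closedBall x t) ∧ μ.real (Metric.closedBall x t) ≤ C * t ^ γ

end GCN

end

/-!
The squared polar sine at `x_i` is the Gram determinant of the `d + 1` unit edge vectors at `x_i`.
Their projections to the direction of a `d`-flat `L` are linearly dependent. Replacing an edge
vector by the combination of all of them given by a dependency with largest coefficient `1` keeps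
the Gram determinant and leaves in its place a vector orthogonal to `L`, so that by Hadamard's
inequality the determinant is at most the squared length of this vector, which is controlled by the
distances to `L` divided by the edge lengths. Hence `c_pol(X)²` is at most
`4 diam(X)² ∑_{i ≠ j} dist(x_i, L)² / ‖x_i - x_j‖²`.

If `γ > 2`, then `∫ ‖x - y‖⁻² dμ(y)` is bounded on the support of `μ`, and integrating the bound for
`c_pol²` gives the inequality for every `L`. If `γ > d`, the trivial bound `c_pol(X)² ≤ diam(μ)²`
suffices, because the least squares error is bounded below: by Fubini over the projections to `L`,
the `ε`-neighbourhood of a `d`-flat has mass of order `ε ^ (γ - d)`, so that for small `ε` half of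
the mass of `μ` lies at distance at least `ε` from every `d`-flat.
-/

namespace GCN

open NormedSpace (normalize norm_smul_normalize)

theorem norm_normalize_le_one {E : Type*} [NormedAddCommGroup E] [NormedSpace ℝ E] (x : E) :
    ‖normalize x‖ ≤ 1 :=
  mem_closedBall_zero_iff.1 (inv_norm_smul_mem_unitClosedBall x)

section GramDeterminant

variable {ι : Type*} [Fintype ι]

theorem exists_normalized_relation_of_not_linearIndependent {V : Type*} [AddCommGroup V]
    [Module ℝ V] {v : ι → V} (hv : ¬ LinearIndependent ℝ v) :
    ∃ (c : ι → ℝ) (i : ι), c i = 1 ∧ (∀ j, |c j| ≤ 1) ∧ ∑ j, c j • v j = 0 := by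
  obtain ⟨a, relation, k, hk⟩ := Fintype.not_linearIndependent_iff.1 hv
  have : Nonempty ι := ⟨k⟩
  obtain ⟨i, hi⟩ := Finite.exists_max fun j => |a j|
  have hai : 0 < |a i| := (abs_pos.2 hk).trans_le (hi k)
  refine ⟨fun j => (a i)⁻¹ * a j, i, inv_mul_cancel₀ (abs_pos.1 hai), fun j => ?_, ?_⟩
  · rw [abs_mul, abs_inv, inv_mul_le_one₀ hai]
    exact hi j
  · simp only [mul_smul, ← Finset.smul_sum, relation, smul_zero]

variable [DecidableEq ι] {H : Type*} [NormedAddCommGroup H] [InnerProductSpace ℝ H]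

theorem det_gram_sum_smul (M : Matrix ι ι ℝ) (y : ι → H) :
    (Matrix.gram ℝ fun k => ∑ l, M k l • y l).det = M.det ^ 2 * (Matrix.gram ℝ y).det := by
  have gram_eq : (Matrix.gram ℝ fun k => ∑ l, M k l • y l) = M * Matrix.gram ℝ y * M.transpose := by
    ext i j
    simp only [Matrix.gram_apply, sum_inner, inner_sum, real_inner_smul_left,
      real_inner_smul_right, Matrix.mul_apply, Matrix.transpose_apply, Finset.sum_mul]
    exact Finset.sum_congr rfl fun _ _ => Finset.sum_congr rfl fun _ _ => by
      ring
  rw [gram_eq, Matrix.det_mul, Matrix.det_mul, Matrix.det_transpose]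
  ring

theorem det_gram_smul (c : ι → ℝ) (y : ι → H) :
    (Matrix.gram ℝ fun k => c k • y k).det = (∏ k, c k) ^ 2 * (Matrix.gram ℝ y).det := by
  rw [← Matrix.det_diagonal, ← det_gram_sum_smul]
  simp [Matrix.diagonal_apply, ite_smul]

theorem det_gram_update_sum_smul (y : ι → H) (i : ι) (c : ι → ℝ) :
    (Matrix.gram ℝ (Function.update y i (∑ j, c j • y j))).det =
      c i ^ 2 * (Matrix.gram ℝ y).det := by
  have det_updateRow : (Matrix.updateRow 1 i c).det = c i := by
    have h := Matrix.det_updateRow_sum (1 : Matrix ι ι ℝ) i c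
    rwa [show ∑ k, c k • (1 : Matrix ι ι ℝ) k = c by ext; simp [Matrix.one_apply], Matrix.det_one,
      smul_eq_mul, mul_one] at h
  rw [← det_updateRow, ← det_gram_sum_smul]
  congr 2 with k
  rcases eq_or_ne k i with rfl | hk
  · simp
  · simp [hk, Matrix.one_apply, ite_smul]

theorem det_gram_update_sub_neg (y : ι → H) (i : ι) :
    (Matrix.gram ℝ (Function.update (fun k => y k - y i) i (-y i))).det =
      (Matrix.gram ℝ y).det := by
  -- The vectors on the left are the rows of `1 - (𝟙 + eᵢ) eᵢᵀ`, a matrix of determinant `-1`,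
  -- applied to `y`.
  let e : ι → ℝ := Pi.single i 1
  let M : Matrix ι ι ℝ :=
    1 + Matrix.replicateCol Unit (-(1 + e)) * Matrix.replicateRow Unit e
  have det_M : M.det = -1 := by
    simp only [M, Matrix.det_one_add_replicateCol_mul_replicateRow]
    simp [e]
  have M_apply : ∀ k l, M k l = (Pi.single k 1 : ι → ℝ) l - (1 + e k) * e l := fun k l => by
    simp only [M, Matrix.add_apply, Matrix.one_apply, Matrix.mul_apply, Pi.add_apply,
      Matrix.replicateCol_apply, Matrix.replicateRow_apply, Finset.univ_unique, Pi.neg_apply,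
      Pi.one_apply, Finset.sum_singleton, Pi.single_apply, eq_comm]
    ring
  have sum_M : ∀ k, ∑ l, M k l • y l = Function.update (fun k => y k - y i) i (-y i) k := by
    intro k
    have : ∑ l, M k l • y l = y k - (1 + e k) • y i := by
      simp [M_apply, e, sub_smul, Finset.sum_sub_distrib, Pi.single_apply, ite_smul]
    rcases eq_or_ne k i with rfl | hk
    · simp [this, e, add_smul]
    · simp [this, e, hk]
  rw [← funext sum_M, det_gram_sum_smul, det_M]
  norm_num

theorem det_gram_le_one_of_norm_le_one {u : ι → H} (hu : ∀ i, ‖u i‖ ≤ 1) :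
    (Matrix.gram ℝ u).det ≤ 1 := by
  have hG := Matrix.posSemidef_gram ℝ u
  have trace_le : (Matrix.gram ℝ u).trace ≤ Fintype.card ι :=
    calc (Matrix.gram ℝ u).trace = ∑ i, ‖u i‖ ^ 2 := by simp [Matrix.trace]
      _ ≤ ∑ _i : ι, 1 := Finset.sum_le_sum fun i _ => pow_le_one₀ (norm_nonneg _) (hu i)
      _ = Fintype.card ι := by simp
  rw [hG.1.trace_eq_sum_eigenvalues] at trace_le
  rw [hG.1.det_eq_prod_eigenvalues]
  simp only [RCLike.ofReal_real_eq_id, id] at trace_le ⊢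
  calc ∏ i, hG.1.eigenvalues i
      ≤ ∏ i, Real.exp (hG.1.eigenvalues i - 1) :=
        Finset.prod_le_prod (fun i _ => hG.eigenvalues_nonneg i) fun i _ => by
          simpa using Real.add_one_le_exp (hG.1.eigenvalues i - 1)
    _ = Real.exp (∑ i, hG.1.eigenvalues i - Fintype.card ι) := by
        rw [← Real.exp_sum, Finset.sum_sub_distrib]
        simp
    _ ≤ 1 := Real.exp_le_one_iff.2 (sub_nonpos.2 trace_le)

theorem det_gram_le_prod_norm_sq (u : ι → H) : (Matrix.gram ℝ u).det ≤ ∏ i, ‖u i‖ ^ 2 := by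
  conv_lhs => rw [← funext fun i => norm_smul_normalize (u i), det_gram_smul]
  rw [Finset.prod_pow]
  exact mul_le_of_le_one_right (sq_nonneg _)
    (det_gram_le_one_of_norm_le_one fun i => norm_normalize_le_one (u i))

theorem det_gram_le_sum_norm_sq_orthogonal (V : Submodule ℝ H) [FiniteDimensional ℝ V]
    (hV : Module.finrank ℝ V < Fintype.card ι) {u : ι → H} (hu : ∀ i, ‖u i‖ ≤ 1) :
    (Matrix.gram ℝ u).det ≤ Fintype.card ι * ∑ i, ‖Vᗮ.starProjection (u i)‖ ^ 2 := by
  have dependent : ¬ LinearIndependent ℝ fun i => V.orthogonalProjectionOnto (u i) :=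
    fun h => hV.not_ge h.fintype_card_le_finrank
  obtain ⟨c, i, hci, hc, relation⟩ :=
    exists_normalized_relation_of_not_linearIndependent dependent
  have sum_eq : ∑ j, c j • u j = ∑ j, c j • Vᗮ.starProjection (u j) := by
    have : ∑ j, c j • V.starProjection (u j) = 0 := by
      simpa using congrArg (Subtype.val : V → H) relation
    simp [Submodule.starProjection_orthogonal_val, smul_sub, this]
  have norm_sum : ‖∑ j, c j • u j‖ ≤ ∑ j, ‖Vᗮ.starProjection (u j)‖ := by
    rw [sum_eq]
    refine norm_sum_le_of_le _ fun j _ => ?_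
    rw [norm_smul]
    exact mul_le_of_le_one_left (norm_nonneg _) (hc j)
  calc (Matrix.gram ℝ u).det
      = (Matrix.gram ℝ (Function.update u i (∑ j, c j • u j))).det := by
        rw [det_gram_update_sum_smul, hci, one_pow, one_mul]
    _ ≤ ∏ k, ‖Function.update u i (∑ j, c j • u j) k‖ ^ 2 := det_gram_le_prod_norm_sq _
    _ ≤ ‖∑ j, c j • u j‖ ^ 2 := by
        rw [← Finset.mul_prod_erase _ _ (Finset.mem_univ i), Function.update_self]
        refine mul_le_of_le_one_right (sq_nonneg _) ?_
        refine Finset.prod_le_one (fun _ _ => sq_nonneg _) fun k hk => ?_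
        rw [Function.update_of_ne (Finset.ne_of_mem_erase hk)]
        exact pow_le_one₀ (norm_nonneg _) (hu k)
    _ ≤ (∑ j, ‖Vᗮ.starProjection (u j)‖) ^ 2 := by gcongr
    _ ≤ Fintype.card ι * ∑ j, ‖Vᗮ.starProjection (u j)‖ ^ 2 := sq_sum_le_card_mul_sum_sq

end GramDeterminant

section Simplex

open Finset (univ)

@[to_additive]
theorem prod_swap_zero_succ {M : Type*} [CommMonoid M] {n : ℕ} (f : Fin (n + 1) → M)
    (i : Fin (n + 1)) :
    ∏ l : Fin n, f (Equiv.swap 0 i l.succ) = ∏ j ∈ univ.erase i, f j := by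
  have erase_eq : univ.erase i = (univ.map (Fin.succEmb n)).map (Equiv.swap 0 i).toEmbedding := by
    have map_succ : univ.map (Fin.succEmb n) = univ.erase 0 := by
      ext j
      cases j using Fin.cases <;> simp
    rw [map_succ, Finset.map_erase, Finset.map_univ_equiv]
    simp
  rw [erase_eq, Finset.prod_map, Finset.prod_map]
  rfl

variable {H : Type*} [NormedAddCommGroup H]

theorem simplexDiam_nonneg {n : ℕ} (X : Fin n → H) : 0 ≤ simplexDiam X := Metric.diam_nonneg

theorem dist_le_simplexDiam {n : ℕ} (X : Fin n → H) (i j : Fin n) :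
    dist (X i) (X j) ≤ simplexDiam X :=
  Metric.dist_le_diam_of_mem (Set.finite_range X).isBounded ⟨i, rfl⟩ ⟨j, rfl⟩

variable [InnerProductSpace ℝ H]

/-- The unit edge vectors of the simplex `X` at its vertex `X i`, indexed so that the edge towards
`X 0` takes the place of the trivial edge towards `X i`. -/
noncomputable def unitEdges {n : ℕ} (X : Fin (n + 1) → H) (i : Fin (n + 1)) (l : Fin n) : H :=
  normalize (X (Equiv.swap 0 i l.succ) - X i)

theorem parVolume_sq {n : ℕ} (X : Fin (n + 1) → H) :
    parVolume X ^ 2 = (Matrix.gram ℝ fun l : Fin n => X l.succ - X 0).det :=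
  Real.sq_sqrt (Matrix.posSemidef_gram ℝ _).det_nonneg

theorem parVolume_comp_swap_zero {n : ℕ} (X : Fin (n + 1) → H) (i : Fin (n + 1)) :
    parVolume (X ∘ Equiv.swap 0 i) = parVolume X := by
  cases i using Fin.cases with
  | zero => simp
  | succ m =>
    unfold parVolume
    rw [← det_gram_update_sub_neg _ m]
    congr with l
    rcases eq_or_ne l m with rfl | hl
    · simp
    · simp [hl, Equiv.swap_apply_of_ne_of_ne]

theorem parVolume_sq_eq {n : ℕ} (X : Fin (n + 1) → H) (i : Fin (n + 1)) :
    parVolume X ^ 2 = (∏ j ∈ univ.erase i, ‖X j - X i‖) ^ 2 *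
      (Matrix.gram ℝ (unitEdges X i)).det := by
  rw [← parVolume_comp_swap_zero X i, parVolume_sq, ← prod_swap_zero_succ, ← det_gram_smul]
  simp [unitEdges]

variable {d : ℕ}

theorem polarSine_sq_le_det_gram (X : Fin (d + 2) → H) (i : Fin (d + 2)) :
    polarSine X i ^ 2 ≤ (Matrix.gram ℝ (unitEdges X i)).det := by
  have det_nonneg := (Matrix.posSemidef_gram ℝ (unitEdges X i)).det_nonneg
  unfold polarSine
  split_ifs
  · rw [div_pow, parVolume_sq_eq X i]
    exact div_le_of_le_mul₀ (sq_nonneg _) det_nonneg (mul_comm _ _).le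
  · simpa using det_nonneg

theorem norm_unitEdges_le_one {n : ℕ} (X : Fin (n + 1) → H) (i : Fin (n + 1)) (l : Fin n) :
    ‖unitEdges X i l‖ ≤ 1 :=
  norm_normalize_le_one _

theorem polarSine_sq_le_one (X : Fin (d + 2) → H) (i : Fin (d + 2)) : polarSine X i ^ 2 ≤ 1 :=
  (polarSine_sq_le_det_gram X i).trans
    (det_gram_le_one_of_norm_le_one (norm_unitEdges_le_one X i))

theorem cPol_sq (X : Fin (d + 2) → H) :
    cPol X ^ 2 = simplexDiam X ^ 2 * ((∑ i, polarSine X i ^ 2) / ((d : ℝ) + 2)) := by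
  rw [cPol, mul_pow, Real.sq_sqrt (by positivity)]

theorem cPol_sq_le_simplexDiam_sq (X : Fin (d + 2) → H) : cPol X ^ 2 ≤ simplexDiam X ^ 2 := by
  rw [cPol_sq]
  refine mul_le_of_le_one_right (sq_nonneg _) (div_le_one_of_le₀ ?_ (by positivity))
  calc ∑ i, polarSine X i ^ 2 ≤ ∑ _i : Fin (d + 2), 1 :=
        Finset.sum_le_sum fun i _ => polarSine_sq_le_one X i
    _ = (d : ℝ) + 2 := by simp

theorem norm_starProjection_orthogonal_sub_le {L : AffineSubspace ℝ H}
    (hL : (L : Set H).Nonempty) [L.direction.HasOrthogonalProjection] (x y : H) :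
    ‖L.directionᗮ.starProjection (x - y)‖ ≤
      Metric.infDist x (L : Set H) + Metric.infDist y (L : Set H) := by
  obtain ⟨p, hp⟩ := hL
  have norm_le : ∀ z, ‖L.directionᗮ.starProjection (z - p)‖ ≤ Metric.infDist z (L : Set H) := by
    refine fun z => (Metric.le_infDist ⟨p, hp⟩).2 fun q hq => ?_
    have projection_eq_zero : L.directionᗮ.starProjection (q - p) = 0 := by
      rw [Submodule.starProjection_apply_eq_zero_iff, Submodule.orthogonal_orthogonal]
      exact L.vsub_mem_direction hq hp
    rw [← sub_add_sub_cancel z q p, map_add, projection_eq_zero, add_zero, dist_eq_norm]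
    exact Submodule.norm_starProjection_apply_le _ _
  rw [← sub_sub_sub_cancel_right x y p, map_sub]
  exact (norm_sub_le _ _).trans (add_le_add (norm_le x) (norm_le y))

theorem dist_le_dist_orthogonalProjectionOnto_add_infDist {L : AffineSubspace ℝ H}
    (hL : (L : Set H).Nonempty) [L.direction.HasOrthogonalProjection] (x y : H) :
    dist x y ≤
      dist (L.direction.orthogonalProjectionOnto x) (L.direction.orthogonalProjectionOnto y) +
        (Metric.infDist x (L : Set H) + Metric.infDist y (L : Set H)) :=
  calc dist x y = ‖L.direction.starProjection (x - y) + L.directionᗮ.starProjection (x - y)‖ := by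
        rw [Submodule.starProjection_add_starProjection_orthogonal, dist_eq_norm]
    _ ≤ ‖L.direction.starProjection (x - y)‖ + ‖L.directionᗮ.starProjection (x - y)‖ :=
        norm_add_le _ _
    _ ≤ _ := by
        gcongr
        · rw [dist_eq_norm, ← map_sub]
          rfl
        · exact norm_starProjection_orthogonal_sub_le hL x y

theorem norm_sq_starProjection_orthogonal_normalize_sub_le {L : AffineSubspace ℝ H}
    (hL : (L : Set H).Nonempty) [L.direction.HasOrthogonalProjection] (x y : H) :
    ‖L.directionᗮ.starProjection (normalize (x - y))‖ ^ 2 ≤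
      2 * (Metric.infDist x (L : Set H) ^ 2 / ‖x - y‖ ^ 2 +
        Metric.infDist y (L : Set H) ^ 2 / ‖y - x‖ ^ 2) := by
  rw [NormedSpace.normalize, map_smul, norm_smul, norm_inv, norm_norm, mul_pow, inv_pow,
    norm_sub_rev y x, ← add_div, ← mul_div_assoc, inv_mul_eq_div]
  gcongr
  exact (pow_le_pow_left₀ (norm_nonneg _)
    (norm_starProjection_orthogonal_sub_le hL x y) 2).trans add_sq_le

theorem polarSine_sq_le_sum_infDist {L : AffineSubspace ℝ H} (hL : L ∈ affineGrassmannian d H)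
    (X : Fin (d + 2) → H) (i : Fin (d + 2)) :
    polarSine X i ^ 2 ≤ 2 * ((d : ℝ) + 1) * ∑ j ∈ univ.erase i,
      (Metric.infDist (X j) (L : Set H) ^ 2 / ‖X j - X i‖ ^ 2 +
        Metric.infDist (X i) (L : Set H) ^ 2 / ‖X i - X j‖ ^ 2) := by
  obtain ⟨nonempty, finiteDimensional, finrank_eq⟩ := hL
  calc polarSine X i ^ 2 ≤ (Matrix.gram ℝ (unitEdges X i)).det := polarSine_sq_le_det_gram X i
    _ ≤ Fintype.card (Fin (d + 1)) *
        ∑ l, ‖L.directionᗮ.starProjection (unitEdges X i l)‖ ^ 2 :=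
      det_gram_le_sum_norm_sq_orthogonal L.direction (by simp [finrank_eq])
        (norm_unitEdges_le_one X i)
    _ ≤ ((d : ℝ) + 1) * ∑ j ∈ univ.erase i, 2 *
        (Metric.infDist (X j) (L : Set H) ^ 2 / ‖X j - X i‖ ^ 2 +
          Metric.infDist (X i) (L : Set H) ^ 2 / ‖X i - X j‖ ^ 2) := by
      rw [← sum_swap_zero_succ, Fintype.card_fin, Nat.cast_succ]
      gcongr
      exact norm_sq_starProjection_orthogonal_normalize_sub_le nonempty _ _
    _ = _ := by
      rw [← Finset.mul_sum]
      ring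

theorem cPol_sq_le_sum_infDist {L : AffineSubspace ℝ H} (hL : L ∈ affineGrassmannian d H)
    (X : Fin (d + 2) → H) :
    cPol X ^ 2 ≤ 4 * simplexDiam X ^ 2 * ∑ i, ∑ j ∈ univ.erase i,
      Metric.infDist (X i) (L : Set H) ^ 2 / ‖X i - X j‖ ^ 2 := by
  let f : Fin (d + 2) → Fin (d + 2) → ℝ := fun i j =>
    Metric.infDist (X i) (L : Set H) ^ 2 / ‖X i - X j‖ ^ 2
  have sum_comm : ∑ i, ∑ j ∈ univ.erase i, f j i = ∑ i, ∑ j ∈ univ.erase i, f i j :=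
    Finset.sum_comm' fun i j => by simp [eq_comm]
  have sum_polarSine_le : ∑ i, polarSine X i ^ 2 ≤
      4 * ((d : ℝ) + 1) * ∑ i, ∑ j ∈ univ.erase i, f i j :=
    calc ∑ i, polarSine X i ^ 2
        ≤ ∑ i, 2 * ((d : ℝ) + 1) * ∑ j ∈ univ.erase i, (f j i + f i j) :=
          Finset.sum_le_sum fun i _ => polarSine_sq_le_sum_infDist hL X i
      _ = 4 * ((d : ℝ) + 1) * ∑ i, ∑ j ∈ univ.erase i, f i j := by
          simp only [← Finset.mul_sum, Finset.sum_add_distrib, sum_comm]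
          ring
  have sum_nonneg : 0 ≤ ∑ i, ∑ j ∈ univ.erase i, f i j := by positivity
  rw [cPol_sq, mul_comm 4, mul_assoc]
  gcongr
  rw [div_le_iff₀ (by positivity)]
  nlinarith

theorem nonempty_affineGrassmannian {u : Fin d → H} (hu : LinearIndependent ℝ u) :
    Nonempty (affineGrassmannian d H) := by
  refine ⟨⟨(Submodule.span ℝ (Set.range u)).toAffineSubspace, ⟨0, Submodule.zero_mem _⟩, ?_, ?_⟩⟩
  · rw [Submodule.toAffineSubspace_direction]
    exact FiniteDimensional.span_of_finite ℝ (Set.finite_range _)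
  · rw [Submodule.toAffineSubspace_direction, finrank_span_eq_card hu, Fintype.card_fin]

theorem cPol_eq_zero_of_isEmpty [isEmpty : IsEmpty (affineGrassmannian d H)]
    (X : Fin (d + 2) → H) : cPol X = 0 := by
  have det_eq_zero : (Matrix.gram ℝ fun l : Fin (d + 1) => X l.succ - X 0).det = 0 := by
    by_contra det_ne_zero
    have independent := Matrix.linearIndependent_of_det_gram_ne_zero det_ne_zero
    exact isEmpty.elim (nonempty_affineGrassmannian
      (independent.comp Fin.castSucc (Fin.castSucc_injective d))).some
  simp [cPol, polarSine, parVolume, det_eq_zero]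

end Simplex

section Measurability

variable {H : Type*} [NormedAddCommGroup H]

theorem lipschitzWith_simplexDiam {n : ℕ} :
    LipschitzWith 2 (simplexDiam : (Fin n → H) → ℝ) := by
  refine LipschitzWith.of_le_add_mul 2 fun X Y => ?_
  refine Metric.diam_le_of_forall_dist_le (add_nonneg (simplexDiam_nonneg Y) (by positivity)) ?_
  rintro _ ⟨i, rfl⟩ _ ⟨j, rfl⟩
  calc dist (X i) (X j) ≤ dist (X i) (Y i) + dist (Y i) (Y j) + dist (Y j) (X j) :=
        dist_triangle4 _ _ _ _
    _ ≤ dist X Y + simplexDiam Y + dist X Y := by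
        rw [dist_comm (Y j)]
        gcongr
        exacts [dist_le_pi_dist X Y i, dist_le_simplexDiam Y i j, dist_le_pi_dist X Y j]
    _ = simplexDiam Y + (2 : NNReal) * dist X Y := by
        push_cast
        ring

variable [InnerProductSpace ℝ H]

theorem continuous_parVolume {n : ℕ} : Continuous (parVolume : (Fin (n + 1) → H) → ℝ) := by
  unfold parVolume
  refine Real.continuous_sqrt.comp (Continuous.matrix_det (continuous_matrix fun i j => ?_))
  simp only [Matrix.gram_apply]
  fun_prop

variable [SecondCountableTopology H] [MeasurableSpace H] [BorelSpace H] {d : ℕ}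

theorem measurable_polarSine (i : Fin (d + 2)) :
    Measurable fun X : Fin (d + 2) → H => polarSine X i := by
  unfold polarSine
  refine Measurable.ite ?_ (continuous_parVolume.measurable.div (by fun_prop)) measurable_const
  simp only [Set.ofPred_forall]
  exact MeasurableSet.iInter fun j => MeasurableSet.iInter fun k => MeasurableSet.iInter fun _ =>
    measurableSet_lt measurable_const (by fun_prop)

theorem measurable_cPol : Measurable fun X : Fin (d + 2) → H => cPol X := by
  unfold cPol
  refine lipschitzWith_simplexDiam.continuous.measurable.mul (Measurable.sqrt ?_)
  exact (Finset.measurable_sum _ fun i _ => (measurable_polarSine i).pow_const 2).div_const _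

end Measurability

section BoundedSupport

variable {H : Type*} [NormedAddCommGroup H] [MeasurableSpace H] {μ : Measure H}

theorem measureDiam_nonneg : 0 ≤ measureDiam μ := Metric.diam_nonneg

theorem simplexDiam_le_measureDiam (hb : Bornology.IsBounded μ.support) {n : ℕ} {X : Fin n → H}
    (hX : ∀ j, X j ∈ μ.support) : simplexDiam X ≤ measureDiam μ :=
  Metric.diam_mono (Set.range_subset_iff.2 hX) hb

theorem ae_pi_mem_support [SecondCountableTopology H] [SigmaFinite μ] {ι : Type*} [Fintype ι] :
    ∀ᵐ X ∂(Measure.pi fun _ : ι => μ), ∀ j, X j ∈ μ.support :=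
  ae_all_iff.2 fun j =>
    (Measure.quasiMeasurePreserving_eval (fun _ : ι => μ) j).ae Measure.support_mem_ae

theorem integrable_infDist_sq [SecondCountableTopology H] [BorelSpace H] [IsFiniteMeasure μ]
    (hb : Bornology.IsBounded μ.support) (s : Set H) :
    Integrable (fun x => Metric.infDist x s ^ 2) μ := by
  obtain ⟨R, hR⟩ := hb.subset_closedBall 0
  refine Integrable.of_bound
    ((Metric.continuous_infDist_pt s).pow 2).measurable.aestronglyMeasurable
    ((Metric.infDist 0 s + R) ^ 2) ?_
  filter_upwards [Measure.support_mem_ae] with x hx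
  rw [Real.norm_of_nonneg (sq_nonneg _)]
  gcongr
  · exact Metric.infDist_nonneg
  · exact Metric.infDist_le_infDist_add_dist.trans (by gcongr; exact hR hx)

variable [InnerProductSpace ℝ H] {d : ℕ}

theorem cPol_sq_le_measureDiam_sq (hb : Bornology.IsBounded μ.support) {X : Fin (d + 2) → H}
    (hX : ∀ j, X j ∈ μ.support) : cPol X ^ 2 ≤ measureDiam μ ^ 2 :=
  (cPol_sq_le_simplexDiam_sq X).trans
    (pow_le_pow_left₀ (simplexDiam_nonneg X) (simplexDiam_le_measureDiam hb hX) 2)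

theorem integrable_cPol_sq [SecondCountableTopology H] [BorelSpace H] [IsFiniteMeasure μ]
    (hb : Bornology.IsBounded μ.support) :
    Integrable (fun X : Fin (d + 2) → H => cPol X ^ 2) (Measure.pi fun _ => μ) := by
  refine Integrable.of_bound (measurable_cPol.pow_const 2).aestronglyMeasurable
    (measureDiam μ ^ 2) ?_
  filter_upwards [ae_pi_mem_support] with X hX
  rw [Real.norm_of_nonneg (sq_nonneg _)]
  exact cPol_sq_le_measureDiam_sq hb hX

theorem integral_cPol_sq_le_measureDiam_sq [SecondCountableTopology H] [BorelSpace H]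
    [IsProbabilityMeasure μ] (hb : Bornology.IsBounded μ.support) :
    ∫ X : Fin (d + 2) → H, cPol X ^ 2 ∂(Measure.pi fun _ => μ) ≤ measureDiam μ ^ 2 := by
  refine (integral_mono_ae (integrable_cPol_sq hb) (integrable_const (measureDiam μ ^ 2))
    ?_).trans_eq (by simp)
  filter_upwards [ae_pi_mem_support] with X hX using cPol_sq_le_measureDiam_sq hb hX

theorem le_mul_lsError_sq [Nonempty (affineGrassmannian d H)] {A K : ℝ} (hK : 0 < K)
    (h : ∀ L ∈ affineGrassmannian d H, A ≤ K * ∫ x, Metric.infDist x (L : Set H) ^ 2 ∂μ) :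
    A ≤ K * lsError μ d ^ 2 := by
  have sqrt_le : √(A / K) ≤ lsError μ d :=
    le_ciInf fun L => Real.sqrt_le_sqrt ((div_le_iff₀' hK).2 (h L.1 L.2))
  exact (div_le_iff₀' hK).1 (Real.sqrt_le_iff.1 sqrt_le).2

theorem integral_cPol_sq_le_mul_lsError_sq {K : ℝ} (hK : 0 < K)
    (h : ∀ L ∈ affineGrassmannian d H, ∫ X : Fin (d + 2) → H, cPol X ^ 2 ∂(Measure.pi fun _ => μ) ≤
      K * ∫ x, Metric.infDist x (L : Set H) ^ 2 ∂μ) :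
    ∫ X : Fin (d + 2) → H, cPol X ^ 2 ∂(Measure.pi fun _ => μ) ≤ K * lsError μ d ^ 2 := by
  cases isEmpty_or_nonempty (affineGrassmannian d H) with
  | inl _ =>
    simp only [cPol_eq_zero_of_isEmpty, ne_eq, two_ne_zero, not_false_eq_true, zero_pow,
      integral_zero]
    positivity
  | inr _ => exact le_mul_lsError_sq hK h

end BoundedSupport

section RieszPotential

theorem setLIntegral_Ioi_rpow_neg {a p : ℝ} (ha : 0 < a) (hp : 1 < p) :
    ∫⁻ t in Set.Ioi a, ENNReal.ofReal (t ^ (-p)) = ENNReal.ofReal (a ^ (1 - p) / (p - 1)) := by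
  rw [← ofReal_integral_eq_lintegral_ofReal (integrableOn_Ioi_rpow_of_lt (by linarith) ha),
    integral_Ioi_rpow_of_lt (by linarith) ha, ← neg_div_neg_eq, neg_neg, neg_add', neg_neg,
    neg_add_eq_sub]
  filter_upwards [self_mem_ae_restrict measurableSet_Ioi] with t ht
  exact Real.rpow_nonneg (ha.trans ht).le _

variable {H : Type*} [NormedAddCommGroup H] [MeasurableSpace H] {μ : Measure H} {γ C : ℝ}

theorem IsRegularWith.isUpperRegularWith (h : IsRegularWith μ γ C) : IsUpperRegularWith μ γ C :=
  ⟨h.1, fun x hx t ht htD => (h.2 x hx t ht htD).2⟩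

variable [IsFiniteMeasure μ]

theorem IsUpperRegularWith.measure_closedBall_le (h : IsUpperRegularWith μ γ C) {x : H}
    (hx : x ∈ μ.support) {t : ℝ} (ht : 0 < t) (htD : t ≤ measureDiam μ) :
    μ (Metric.closedBall x t) ≤ ENNReal.ofReal (C * t ^ γ) := by
  rw [← ofReal_measureReal]
  exact ENNReal.ofReal_le_ofReal (h.2 x hx t ht htD)

variable {s : ℝ}

theorem IsUpperRegularWith.measure_le_norm_rpow_neg_le (h : IsUpperRegularWith μ γ C)
    (hD : 0 < measureDiam μ) (hs : 0 < s) {x : H} (hx : x ∈ μ.support) {t : ℝ}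
    (ht : measureDiam μ ^ (-s) ≤ t) :
    μ {y | t ≤ ‖x - y‖ ^ (-s)} ≤ ENNReal.ofReal (C * t ^ (-(γ / s))) := by
  have t_pos : 0 < t := (Real.rpow_pos_of_pos hD _).trans_le ht
  have subset : {y | t ≤ ‖x - y‖ ^ (-s)} ⊆ Metric.closedBall x (t ^ (-s)⁻¹) := fun y hy => by
    rcases (norm_nonneg (x - y)).eq_or_lt with h0 | hpos
    · rw [Metric.mem_closedBall', dist_eq_norm, ← h0]
      positivity
    · rw [Metric.mem_closedBall', dist_eq_norm]
      exact (Real.le_rpow_inv_iff_of_neg hpos t_pos (neg_neg_of_pos hs)).2 hy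
  have radius_le : t ^ (-s)⁻¹ ≤ measureDiam μ :=
    (Real.rpow_inv_le_iff_of_neg t_pos hD (neg_neg_of_pos hs)).2 ht
  calc μ {y | t ≤ ‖x - y‖ ^ (-s)} ≤ μ (Metric.closedBall x (t ^ (-s)⁻¹)) := measure_mono subset
    _ ≤ ENNReal.ofReal (C * (t ^ (-s)⁻¹) ^ γ) :=
      h.measure_closedBall_le hx (Real.rpow_pos_of_pos t_pos _) radius_le
    _ = ENNReal.ofReal (C * t ^ (-(γ / s))) := by
      rw [← Real.rpow_mul t_pos.le, inv_neg, neg_mul, inv_mul_eq_div]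

variable [SecondCountableTopology H]

theorem IsUpperRegularWith.measure_le_of_forall_dist_le (h : IsUpperRegularWith μ γ C) {T : Set H}
    {t : ℝ} (ht : 0 < t) (htD : t ≤ measureDiam μ)
    (hT : ∀ x ∈ T ∩ μ.support, ∀ y ∈ T ∩ μ.support, dist y x ≤ t) :
    μ T ≤ ENNReal.ofReal (C * t ^ γ) := by
  rw [← measure_inter_conull Measure.measure_compl_support]
  rcases (T ∩ μ.support).eq_empty_or_nonempty with empty | ⟨x, hx⟩
  · simp [empty]
  · exact (measure_mono (hT x hx)).trans (h.measure_closedBall_le hx.2 ht htD)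

theorem IsUpperRegularWith.measure_univ_le (h : IsUpperRegularWith μ γ C)
    (hb : Bornology.IsBounded μ.support) (hD : 0 < measureDiam μ) :
    μ Set.univ ≤ ENNReal.ofReal (C * measureDiam μ ^ γ) :=
  h.measure_le_of_forall_dist_le hD le_rfl fun _ hx _ hy =>
    Metric.dist_le_diam_of_mem hb hy.2 hx.2

/-- A bound for the Riesz potential `∫ ‖x - y‖⁻ˢ dμ(y)` at points `x` of the support of a
`γ`-upper-regular measure with constant `C` and diameter `D`, valid for `0 < s < γ`. -/
noncomputable def rieszPotentialBound (γ C D s : ℝ) : ℝ :=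
  C * (γ / (γ - s) * D ^ (γ - s))

theorem IsUpperRegularWith.lintegral_norm_rpow_neg_le [OpensMeasurableSpace H]
    (h : IsUpperRegularWith μ γ C) (hb : Bornology.IsBounded μ.support)
    (hD : 0 < measureDiam μ) (hs : 0 < s) (hsγ : s < γ) {x : H} (hx : x ∈ μ.support) :
    ∫⁻ y, ENNReal.ofReal (‖x - y‖ ^ (-s)) ∂μ ≤
      ENNReal.ofReal (rieszPotentialBound γ C (measureDiam μ) s) := by
  set D := measureDiam μ
  have γ_sub_pos : 0 < γ - s := sub_pos.2 hsγ
  have C_nonneg : 0 ≤ C := zero_le_one.trans h.1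
  have a_pos : 0 < D ^ (-s) := Real.rpow_pos_of_pos hD _
  have one_lt : 1 < γ / s := (one_lt_div hs).2 hsγ
  have tail_eq : ∫⁻ t in Set.Ioi (D ^ (-s)), ENNReal.ofReal (C * t ^ (-(γ / s))) =
      ENNReal.ofReal (C * ((D ^ (-s)) ^ (1 - γ / s) / (γ / s - 1))) := by
    simp only [ENNReal.ofReal_mul C_nonneg]
    rw [lintegral_const_mul' _ _ ENNReal.ofReal_ne_top, setLIntegral_Ioi_rpow_neg a_pos one_lt]
  calc ∫⁻ y, ENNReal.ofReal (‖x - y‖ ^ (-s)) ∂μ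
      = ∫⁻ t in Set.Ioi 0, μ {y | t ≤ ‖x - y‖ ^ (-s)} :=
        lintegral_eq_lintegral_meas_le μ (.of_forall fun y => by positivity)
          ((continuous_const.sub continuous_id).norm.measurable.pow_const _).aemeasurable
    _ ≤ (∫⁻ t in Set.Ioc 0 (D ^ (-s)), μ {y | t ≤ ‖x - y‖ ^ (-s)}) +
        ∫⁻ t in Set.Ioi (D ^ (-s)), μ {y | t ≤ ‖x - y‖ ^ (-s)} := by
        rw [← Set.Ioc_union_Ioi_eq_Ioi a_pos.le]
        exact lintegral_union_le _ _ _
    _ ≤ (∫⁻ _t in Set.Ioc 0 (D ^ (-s)), ENNReal.ofReal (C * D ^ γ)) +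
        ∫⁻ t in Set.Ioi (D ^ (-s)), ENNReal.ofReal (C * t ^ (-(γ / s))) := by
        gcongr ?_ + ?_
        · exact lintegral_mono fun t => (measure_mono (Set.subset_univ _)).trans
            (h.measure_univ_le hb hD)
        · exact setLIntegral_mono' measurableSet_Ioi fun t ht =>
            h.measure_le_norm_rpow_neg_le hD hs hx ht.le
    _ = ENNReal.ofReal (C * D ^ γ * D ^ (-s) +
          C * ((D ^ (-s)) ^ (1 - γ / s) / (γ / s - 1))) := by
        rw [tail_eq, setLIntegral_const, Real.volume_Ioc, sub_zero,
          ← ENNReal.ofReal_mul (by positivity),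
          ← ENNReal.ofReal_add (by positivity) (by have := sub_pos.2 one_lt; positivity)]
    _ = ENNReal.ofReal (rieszPotentialBound γ C D s) := by
        rw [rieszPotentialBound, mul_assoc, ← Real.rpow_add hD, ← Real.rpow_mul hD.le,
          ← sub_eq_add_neg, show -s * (1 - γ / s) = γ - s by field_simp; ring]
        congr 1
        field_simp
        ring

end RieszPotential

section LargeExponent

theorem map_pi_eval_pair {ι : Type*} [Fintype ι] {Ω : ι → Type*} [∀ i, MeasurableSpace (Ω i)]
    (μ : ∀ i, Measure (Ω i)) [∀ i, IsProbabilityMeasure (μ i)] {i j : ι} (hij : i ≠ j) :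
    (Measure.pi μ).map (fun X => (X i, X j)) = (μ i).prod (μ j) := by
  have indep := (ProbabilityTheory.iIndepFun_pi (μ := μ) (X := fun _ => id)
    fun _ => aemeasurable_id).indepFun hij
  have map_prod := (ProbabilityTheory.indepFun_iff_map_prod_eq_prod_map_map
    (measurable_pi_apply i).aemeasurable (measurable_pi_apply j).aemeasurable).1 indep
  have map_eval (k : ι) : (Measure.pi μ).map (fun X => X k) = μ k :=
    (measurePreserving_eval μ k).map_eq
  rwa [map_eval, map_eval] at map_prod

theorem ofReal_cPol_sq_le_sum_infDist {H : Type*} [NormedAddCommGroup H] [InnerProductSpace ℝ H]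
    [MeasurableSpace H] {μ : Measure H} {d : ℕ} (hb : Bornology.IsBounded μ.support)
    {L : AffineSubspace ℝ H} (hL : L ∈ affineGrassmannian d H) {X : Fin (d + 2) → H}
    (hX : ∀ j, X j ∈ μ.support) :
    ENNReal.ofReal (cPol X ^ 2) ≤ ENNReal.ofReal (4 * measureDiam μ ^ 2) *
      ∑ i, ∑ j ∈ Finset.univ.erase i, ENNReal.ofReal (Metric.infDist (X i) (L : Set H) ^ 2) *
        ENNReal.ofReal (‖X i - X j‖ ^ (-2 : ℝ)) := by
  have ofReal_sum : ∑ i, ∑ j ∈ Finset.univ.erase i,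
      ENNReal.ofReal (Metric.infDist (X i) (L : Set H) ^ 2) *
        ENNReal.ofReal (‖X i - X j‖ ^ (-2 : ℝ)) =
      ENNReal.ofReal (∑ i, ∑ j ∈ Finset.univ.erase i,
        Metric.infDist (X i) (L : Set H) ^ 2 / ‖X i - X j‖ ^ 2) := by
    rw [ENNReal.ofReal_sum_of_nonneg fun _ _ => by positivity]
    refine Finset.sum_congr rfl fun i _ => ?_
    rw [ENNReal.ofReal_sum_of_nonneg fun _ _ => by positivity]
    refine Finset.sum_congr rfl fun j _ => ?_
    rw [← ENNReal.ofReal_mul (sq_nonneg _), Real.rpow_neg (norm_nonneg _), Real.rpow_two,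
      div_eq_mul_inv]
  rw [ofReal_sum, ← ENNReal.ofReal_mul (by positivity)]
  refine ENNReal.ofReal_le_ofReal ((cPol_sq_le_sum_infDist hL X).trans ?_)
  have simplexDiam_le := simplexDiam_le_measureDiam hb hX
  have simplexDiam_nonneg := simplexDiam_nonneg X
  gcongr

variable {H : Type*} [NormedAddCommGroup H] [SecondCountableTopology H] [MeasurableSpace H]
  [BorelSpace H] {μ : Measure H} [IsProbabilityMeasure μ] {γ C s : ℝ}

theorem IsUpperRegularWith.lintegral_pi_mul_norm_rpow_neg_le (h : IsUpperRegularWith μ γ C)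
    (hb : Bornology.IsBounded μ.support) (hD : 0 < measureDiam μ) (hs : 0 < s) (hsγ : s < γ)
    {f : H → ENNReal} (hf : Measurable f) {ι : Type*} [Fintype ι] {i j : ι} (hij : i ≠ j) :
    ∫⁻ X : ι → H, f (X i) * ENNReal.ofReal (‖X i - X j‖ ^ (-s)) ∂(Measure.pi fun _ => μ) ≤
      ENNReal.ofReal (rieszPotentialBound γ C (measureDiam μ) s) * ∫⁻ x, f x ∂μ := by
  have measurable_integrand :
      Measurable fun p : H × H => f p.1 * ENNReal.ofReal (‖p.1 - p.2‖ ^ (-s)) := by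
    fun_prop
  calc _ = ∫⁻ p, f p.1 * ENNReal.ofReal (‖p.1 - p.2‖ ^ (-s)) ∂(μ.prod μ) := by
        rw [← map_pi_eval_pair (fun _ => μ) hij,
          lintegral_map measurable_integrand (by fun_prop)]
    _ = ∫⁻ x, f x * ∫⁻ y, ENNReal.ofReal (‖x - y‖ ^ (-s)) ∂μ ∂μ := by
        rw [lintegral_prod _ measurable_integrand.aemeasurable]
        refine lintegral_congr fun x => lintegral_const_mul (f x) ?_
        fun_prop
    _ ≤ ∫⁻ x, f x * ENNReal.ofReal (rieszPotentialBound γ C (measureDiam μ) s) ∂μ := by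
        refine lintegral_mono_ae ?_
        filter_upwards [Measure.support_mem_ae] with x hx
        gcongr
        exact h.lintegral_norm_rpow_neg_le hb hD hs hsγ hx
    _ = _ := by rw [lintegral_mul_const _ hf, mul_comm]

variable [InnerProductSpace ℝ H] {d : ℕ}

theorem IsUpperRegularWith.lintegral_cPol_sq_le_of_two_lt (h : IsUpperRegularWith μ γ C)
    (hb : Bornology.IsBounded μ.support) (hD : 0 < measureDiam μ) (hγ : 2 < γ)
    {L : AffineSubspace ℝ H} (hL : L ∈ affineGrassmannian d H) :
    ∫⁻ X : Fin (d + 2) → H, ENNReal.ofReal (cPol X ^ 2) ∂(Measure.pi fun _ => μ) ≤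
      ENNReal.ofReal (4 * measureDiam μ ^ 2) * (((d + 2) * (d + 1) : ℕ) *
        (ENNReal.ofReal (rieszPotentialBound γ C (measureDiam μ) 2) *
          ∫⁻ x, ENNReal.ofReal (Metric.infDist x (L : Set H) ^ 2) ∂μ)) := by
  let f : H → ENNReal := fun x => ENNReal.ofReal (Metric.infDist x (L : Set H) ^ 2)
  have measurable_f : Measurable f :=
    ((Metric.continuous_infDist_pt _).pow 2).measurable.ennreal_ofReal
  calc _ ≤ ∫⁻ X : Fin (d + 2) → H, ENNReal.ofReal (4 * measureDiam μ ^ 2) *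
        ∑ i, ∑ j ∈ Finset.univ.erase i, f (X i) * ENNReal.ofReal (‖X i - X j‖ ^ (-2 : ℝ))
          ∂(Measure.pi fun _ => μ) := by
        refine lintegral_mono_ae ?_
        filter_upwards [ae_pi_mem_support] with X hX
        exact ofReal_cPol_sq_le_sum_infDist hb hL hX
    _ = ENNReal.ofReal (4 * measureDiam μ ^ 2) * ∑ i, ∑ j ∈ Finset.univ.erase i,
        ∫⁻ X : Fin (d + 2) → H, f (X i) * ENNReal.ofReal (‖X i - X j‖ ^ (-2 : ℝ))
          ∂(Measure.pi fun _ => μ) := by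
        rw [lintegral_const_mul' _ _ ENNReal.ofReal_ne_top, lintegral_finsetSum _ (by fun_prop)]
        congr! 2 with i
        exact lintegral_finsetSum _ (by fun_prop)
    _ ≤ ENNReal.ofReal (4 * measureDiam μ ^ 2) * ∑ i : Fin (d + 2), ∑ _j ∈ Finset.univ.erase i,
        ENNReal.ofReal (rieszPotentialBound γ C (measureDiam μ) 2) * ∫⁻ x, f x ∂μ := by
        gcongr with i _ j hj
        exact h.lintegral_pi_mul_norm_rpow_neg_le hb hD two_pos hγ measurable_f
          (Finset.ne_of_mem_erase hj).symm
    _ = _ := by simp [mul_assoc, f]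

theorem IsUpperRegularWith.integral_cPol_sq_le_of_two_lt (h : IsUpperRegularWith μ γ C)
    (hb : Bornology.IsBounded μ.support) (hD : 0 < measureDiam μ) (hγ : 2 < γ)
    {L : AffineSubspace ℝ H} (hL : L ∈ affineGrassmannian d H) :
    ∫ X : Fin (d + 2) → H, cPol X ^ 2 ∂(Measure.pi fun _ => μ) ≤
      4 * measureDiam μ ^ 2 * ((d + 2) * (d + 1) : ℕ) *
        rieszPotentialBound γ C (measureDiam μ) 2 *
        ∫ x, Metric.infDist x (L : Set H) ^ 2 ∂μ := by
  have bound_nonneg : 0 ≤ rieszPotentialBound γ C (measureDiam μ) 2 := by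
    have : 0 < γ - 2 := sub_pos.2 hγ
    have : 0 ≤ C := zero_le_one.trans h.1
    unfold rieszPotentialBound
    positivity
  rw [← ENNReal.ofReal_le_ofReal_iff (by positivity), mul_assoc, mul_assoc,
    ENNReal.ofReal_mul (p := 4 * measureDiam μ ^ 2) (by positivity),
    ENNReal.ofReal_mul (Nat.cast_nonneg _), ENNReal.ofReal_mul bound_nonneg, ENNReal.ofReal_natCast,
    ofReal_integral_eq_lintegral_ofReal (integrable_cPol_sq hb) (.of_forall fun _ => sq_nonneg _),
    ofReal_integral_eq_lintegral_ofReal (integrable_infDist_sq hb _)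
      (.of_forall fun _ => sq_nonneg _)]
  exact h.lintegral_cPol_sq_le_of_two_lt hb hD hγ hL

end LargeExponent

section SmallExponent

theorem measure_closedBall_mul_pow_finrank_le {E : Type*} [NormedAddCommGroup E] [NormedSpace ℝ E]
    [FiniteDimensional ℝ E] [MeasurableSpace E] [BorelSpace E] (ν : Measure E) [SFinite ν]
    {r R : ℝ} (hr : 0 ≤ r) (hR : 0 ≤ R) {m : ENNReal} (hm : ∀ y, ν (Metric.closedBall y r) ≤ m)
    (y₀ : E) :
    ν (Metric.closedBall y₀ R) * ENNReal.ofReal (r ^ Module.finrank ℝ E) ≤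
      m * ENNReal.ofReal ((R + r) ^ Module.finrank ℝ E) := by
  let vol : Measure E := Measure.addHaar
  have vol_ball_ne_zero : vol (Metric.ball 0 1) ≠ 0 :=
    (Metric.measure_ball_pos vol 0 one_pos).ne'
  have vol_ball_ne_top : vol (Metric.ball 0 1) ≠ ⊤ := measure_ball_lt_top.ne
  have measurableSet_near : MeasurableSet {p : E × E | dist p.2 p.1 ≤ r} :=
    measurableSet_le (by fun_prop) (by fun_prop)
  have fibre_le (y : E) : ν.restrict (Metric.closedBall y₀ R) (Metric.closedBall y r) ≤
      (Metric.closedBall y₀ (R + r)).indicator (fun _ => m) y := by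
    rw [Measure.restrict_apply Metric.isClosed_closedBall.measurableSet]
    by_cases hy : y ∈ Metric.closedBall y₀ (R + r)
    · rw [Set.indicator_of_mem hy]
      exact (measure_mono Set.inter_subset_left).trans (hm y)
    · rw [(Metric.closedBall_disjoint_closedBall ?_).inter_eq, measure_empty]
      · exact zero_le
      · rw [add_comm]
        exact not_le.1 hy
  rw [← ENNReal.mul_le_mul_iff_left vol_ball_ne_zero vol_ball_ne_top, mul_assoc, mul_assoc,
    ← Measure.addHaar_closedBall vol y₀ (add_nonneg hR hr)]
  calc ν (Metric.closedBall y₀ R) *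
        (ENNReal.ofReal (r ^ Module.finrank ℝ E) * vol (Metric.ball 0 1))
      = ∫⁻ x in Metric.closedBall y₀ R, vol (Metric.closedBall x r) ∂ν := by
        simp [Measure.addHaar_closedBall vol _ hr, mul_comm]
    _ = (ν.restrict (Metric.closedBall y₀ R)).prod vol {p | dist p.2 p.1 ≤ r} :=
        (Measure.prod_apply measurableSet_near).symm
    _ = ∫⁻ y, ν.restrict (Metric.closedBall y₀ R) (Metric.closedBall y r) ∂vol := by
        rw [Measure.prod_apply_symm measurableSet_near]
        exact lintegral_congr fun y => congrArg _ (Set.ext fun x => Metric.mem_closedBall'.symm)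
    _ ≤ ∫⁻ y, (Metric.closedBall y₀ (R + r)).indicator (fun _ => m) y ∂vol :=
        lintegral_mono fibre_le
    _ = m * vol (Metric.closedBall y₀ (R + r)) :=
        lintegral_indicator_const Metric.isClosed_closedBall.measurableSet m

theorem exists_pos_mul_rpow_mul_pow_le {d : ℕ} {γ D : ℝ} (hγ : d < γ) (hD : 0 < D) (C : ℝ) :
    ∃ ε : ℝ, 0 < ε ∧ 4 * ε ≤ D ∧ C * (4 * ε) ^ γ * (D + ε) ^ d ≤ ε ^ d / 2 := by
  have exponent_pos : 0 < γ - d := sub_pos.2 hγ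
  have tendsto_zero : Filter.Tendsto (fun ε : ℝ => C * 4 ^ γ * ε ^ (γ - d) * (D + ε) ^ d)
      (nhdsWithin 0 (Set.Ioi 0)) (nhds 0) := by
    have continuous : ContinuousAt (fun ε : ℝ => C * 4 ^ γ * ε ^ (γ - d) * (D + ε) ^ d) 0 := by
      have := Real.continuousAt_rpow_const 0 (γ - d) (.inr exponent_pos.le)
      fun_prop
    simpa [Real.zero_rpow exponent_pos.ne'] using continuous.tendsto.mono_left nhdsWithin_le_nhds
  obtain ⟨ε, small, hε, hεD⟩ := ((tendsto_zero.eventually_lt_const one_half_pos).and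
    (Ioc_mem_nhdsGT (show 0 < D / 4 by positivity))).exists
  refine ⟨ε, hε, by linarith, ?_⟩
  calc C * (4 * ε) ^ γ * (D + ε) ^ d
      = ε ^ d * (C * 4 ^ γ * ε ^ (γ - d) * (D + ε) ^ d) := by
        have rpow_eq : ε ^ γ = ε ^ d * ε ^ (γ - d) := by
          rw [← Real.rpow_natCast, ← Real.rpow_add hε, add_sub_cancel]
        rw [Real.mul_rpow zero_le_four hε.le, rpow_eq]
        ring
    _ ≤ ε ^ d * (1 / 2) := by gcongr
    _ = ε ^ d / 2 := by ring

variable {H : Type*} [NormedAddCommGroup H] [MeasurableSpace H] {μ : Measure H}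

theorem sq_div_two_le_integral_infDist_sq [SecondCountableTopology H] [BorelSpace H]
    [IsProbabilityMeasure μ] (hb : Bornology.IsBounded μ.support) {s : Set H} {ε : ℝ}
    (hε : 0 ≤ ε) (hs : μ.real {x | Metric.infDist x s ≤ ε} ≤ 1 / 2) :
    ε ^ 2 / 2 ≤ ∫ x, Metric.infDist x s ^ 2 ∂μ := by
  have measurableSet_tube : MeasurableSet {x | Metric.infDist x s ≤ ε} :=
    measurableSet_le (by fun_prop) measurable_const
  have far_subset : {x | Metric.infDist x s ≤ ε}ᶜ ⊆ {x | ε ^ 2 ≤ Metric.infDist x s ^ 2} :=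
    fun x hx => pow_le_pow_left₀ hε (not_le.1 (Set.notMem_ofPred_iff.1 hx)).le 2
  have markov := mul_meas_ge_le_integral_of_nonneg (.of_forall fun _ => sq_nonneg _)
    (integrable_infDist_sq hb s) (ε ^ 2)
  have half_le : 1 / 2 ≤ μ.real {x | ε ^ 2 ≤ Metric.infDist x s ^ 2} :=
    calc 1 / 2 ≤ μ.real {x | Metric.infDist x s ≤ ε}ᶜ := by
          rw [probReal_compl_eq_one_sub measurableSet_tube]
          linarith
      _ ≤ _ := measureReal_mono far_subset
  calc ε ^ 2 / 2 = ε ^ 2 * (1 / 2) := by ring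
    _ ≤ ε ^ 2 * μ.real {x | ε ^ 2 ≤ Metric.infDist x s ^ 2} := by gcongr
    _ ≤ _ := markov

variable [InnerProductSpace ℝ H] [SecondCountableTopology H] [BorelSpace H] {γ C : ℝ} {d : ℕ}
  {L : AffineSubspace ℝ H} {ε : ℝ}

theorem IsUpperRegularWith.measure_infDist_le_mul_pow_le [IsFiniteMeasure μ]
    (h : IsUpperRegularWith μ γ C) (hb : Bornology.IsBounded μ.support)
    (hL : L ∈ affineGrassmannian d H) (hε : 0 < ε) (hεD : 4 * ε ≤ measureDiam μ) :
    μ {x | Metric.infDist x (L : Set H) ≤ ε} * ENNReal.ofReal (ε ^ d) ≤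
      ENNReal.ofReal (C * (4 * ε) ^ γ) * ENNReal.ofReal ((measureDiam μ + ε) ^ d) := by
  obtain ⟨nonempty, finiteDimensional, rfl⟩ := hL
  let P := L.direction.orthogonalProjectionOnto
  let T : Set H := {x | Metric.infDist x (L : Set H) ≤ ε}
  have map_apply (y : L.direction) (r : ℝ) : (μ.restrict T).map P (Metric.closedBall y r) =
      μ (P ⁻¹' Metric.closedBall y r ∩ T) := by
    have measurableSet_ball : MeasurableSet (Metric.closedBall y r) :=
      Metric.isClosed_closedBall.measurableSet
    rw [Measure.map_apply (by fun_prop) measurableSet_ball,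
      Measure.restrict_apply (P.measurable measurableSet_ball)]
  have fibre_le (y : L.direction) :
      (μ.restrict T).map P (Metric.closedBall y ε) ≤ ENNReal.ofReal (C * (4 * ε) ^ γ) := by
    rw [map_apply]
    refine h.measure_le_of_forall_dist_le (by positivity) hεD ?_
    rintro x ⟨⟨hPx, hTx : Metric.infDist x L ≤ ε⟩, -⟩
      x' ⟨⟨hPx', hTx' : Metric.infDist x' L ≤ ε⟩, -⟩
    have dist_projection_le : dist (P x') (P x) ≤ ε + ε :=
      (dist_triangle_right _ _ y).trans (add_le_add hPx' hPx)
    linarith [dist_le_dist_orthogonalProjectionOnto_add_infDist nonempty x' x]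
  obtain ⟨x₀, hx₀⟩ : μ.support.Nonempty := by
    by_contra! empty
    simp only [measureDiam, empty, Metric.diam_empty] at hεD
    linarith
  have projection_subset : μ.support ∩ T ⊆ P ⁻¹' Metric.closedBall (P x₀) (measureDiam μ) ∩ T := by
    refine Set.inter_subset_inter_left _ fun x hx => ?_
    calc dist (P x) (P x₀) ≤ dist x x₀ := by
          rw [dist_eq_norm, dist_eq_norm, ← map_sub]
          exact Submodule.norm_orthogonalProjectionOnto_apply_le _ _
      _ ≤ measureDiam μ := Metric.dist_le_diam_of_mem hb hx hx₀
  calc μ T * ENNReal.ofReal (ε ^ Module.finrank ℝ L.direction)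
      ≤ (μ.restrict T).map P (Metric.closedBall (P x₀) (measureDiam μ)) *
          ENNReal.ofReal (ε ^ Module.finrank ℝ L.direction) := by
        gcongr
        rw [map_apply, ← measure_inter_conull Measure.measure_compl_support, Set.inter_comm]
        exact measure_mono projection_subset
    _ ≤ _ := measure_closedBall_mul_pow_finrank_le _ hε.le measureDiam_nonneg fibre_le _

variable [IsProbabilityMeasure μ]

theorem IsUpperRegularWith.measureReal_infDist_le_le_half (h : IsUpperRegularWith μ γ C)
    (hb : Bornology.IsBounded μ.support) (hL : L ∈ affineGrassmannian d H) (hε : 0 < ε)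
    (hεD : 4 * ε ≤ measureDiam μ)
    (hmass : C * (4 * ε) ^ γ * (measureDiam μ + ε) ^ d ≤ ε ^ d / 2) :
    μ.real {x | Metric.infDist x (L : Set H) ≤ ε} ≤ 1 / 2 := by
  have tube_le := h.measure_infDist_le_mul_pow_le hb hL hε hεD
  have C_nonneg : 0 ≤ C := zero_le_one.trans h.1
  have D_nonneg : 0 ≤ measureDiam μ := measureDiam_nonneg
  rw [← ENNReal.ofReal_mul (by positivity), ← ofReal_measureReal,
    ← ENNReal.ofReal_mul measureReal_nonneg, ENNReal.ofReal_le_ofReal_iff (by positivity)]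
    at tube_le
  rw [le_div_iff₀ (by positivity : (0 : ℝ) < 2)] at hmass
  refine le_of_mul_le_mul_right ?_ (pow_pos hε d)
  linarith

theorem IsUpperRegularWith.integral_cPol_sq_le_of_mul_rpow_mul_pow_le (h : IsUpperRegularWith μ γ C)
    (hb : Bornology.IsBounded μ.support) (hL : L ∈ affineGrassmannian d H) (hε : 0 < ε)
    (hεD : 4 * ε ≤ measureDiam μ)
    (hmass : C * (4 * ε) ^ γ * (measureDiam μ + ε) ^ d ≤ ε ^ d / 2) :
    ∫ X : Fin (d + 2) → H, cPol X ^ 2 ∂(Measure.pi fun _ => μ) ≤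
      measureDiam μ ^ 2 / (ε ^ 2 / 2) * ∫ x, Metric.infDist x (L : Set H) ^ 2 ∂μ := by
  have tube_le := h.measureReal_infDist_le_le_half hb hL hε hεD hmass
  calc _ ≤ measureDiam μ ^ 2 := integral_cPol_sq_le_measureDiam_sq hb
    _ = measureDiam μ ^ 2 / (ε ^ 2 / 2) * (ε ^ 2 / 2) := by field_simp
    _ ≤ _ := by
        gcongr
        exact sq_div_two_le_integral_infDist_sq hb hε.le tube_le

end SmallExponent

theorem exists_forall_integral_cPol_sq_le_mul_integral_infDist_sq (d : ℕ) (γ D C : ℝ)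
    (hγ : min 2 (d : ℝ) < γ) :
    ∃ K : ℝ, ∀ (H : Type*) [NormedAddCommGroup H] [InnerProductSpace ℝ H]
      [SecondCountableTopology H] [MeasurableSpace H] [BorelSpace H] (μ : Measure H)
      [IsProbabilityMeasure μ], Bornology.IsBounded μ.support → measureDiam μ = D →
      IsUpperRegularWith μ γ C → ∀ L ∈ affineGrassmannian d H,
      ∫ X : Fin (d + 2) → H, cPol X ^ 2 ∂(Measure.pi fun _ => μ) ≤
        K * ∫ x, Metric.infDist x (L : Set H) ^ 2 ∂μ := by
  rcases le_or_gt D 0 with D_nonpos | D_pos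
  · refine ⟨0, fun H _ _ _ _ _ μ _ hb hD _ L _ => ?_⟩
    have D_eq_zero : measureDiam μ = 0 := le_antisymm (hD.trans_le D_nonpos) measureDiam_nonneg
    simpa [D_eq_zero] using integral_cPol_sq_le_measureDiam_sq (d := d) hb
  rcases min_lt_iff.1 hγ with two_lt | d_lt
  · refine ⟨4 * D ^ 2 * ((d + 2) * (d + 1) : ℕ) * rieszPotentialBound γ C D 2, ?_⟩
    rintro H _ _ _ _ _ μ _ hb rfl h L hL
    exact h.integral_cPol_sq_le_of_two_lt hb D_pos two_lt hL
  · obtain ⟨ε, hε, hεD, hmass⟩ := exists_pos_mul_rpow_mul_pow_le d_lt D_pos C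
    refine ⟨D ^ 2 / (ε ^ 2 / 2), ?_⟩
    rintro H _ _ _ _ _ μ _ hb rfl h L hL
    exact h.integral_cPol_sq_le_of_mul_rpow_mul_pow_le hb hL hε hεD hmass

end GCN

theorem mainTheorem2_general (d : ℕ) (γ D C : ℝ) (hγ : min 2 (d : ℝ) < γ) :
    ∃ K : ℝ, 0 < K ∧
      ∀ (H : Type*) [NormedAddCommGroup H] [InnerProductSpace ℝ H]
        [TopologicalSpace.SeparableSpace H] [MeasurableSpace H] [BorelSpace H]
        (μ : Measure H) [IsProbabilityMeasure μ],
        Bornology.IsBounded μ.support →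
        GCN.measureDiam μ = D →
        GCN.IsUpperRegularWith μ γ C →
        Integrable (fun X : Fin (d + 2) → H => GCN.cPol X ^ 2) (Measure.pi fun _ => μ) ∧
          ∫ X : Fin (d + 2) → H, GCN.cPol X ^ 2 ∂(Measure.pi fun _ => μ) ≤
            K * GCN.lsError μ d ^ 2 := by
  obtain ⟨K, hK⟩ := GCN.exists_forall_integral_cPol_sq_le_mul_integral_infDist_sq d γ D C hγ
  refine ⟨max 1 K, by positivity, fun H _ _ _ _ _ μ _ hb hD h => ?_⟩
  have := UniformSpace.secondCountable_of_separable H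
  refine ⟨GCN.integrable_cPol_sq hb, GCN.integral_cPol_sq_le_mul_lsError_sq (by positivity)
    fun L hL => (hK H μ hb hD h L hL).trans ?_⟩
  gcongr
  exact le_max_right 1 K

theorem mainTheorem2 (d : ℕ) (γ D C : ℝ) :
    ∃ K : ℝ, 0 < K ∧
      ∀ (H : Type*) [NormedAddCommGroup H] [InnerProductSpace ℝ H] [CompleteSpace H]
        [TopologicalSpace.SeparableSpace H] [MeasurableSpace H] [BorelSpace H]
        (μ : Measure H) [IsProbabilityMeasure μ],
        Bornology.IsBounded μ.support →
        GCN.measureDiam μ = D →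
        ((2 < γ ∧ GCN.IsUpperRegularWith μ γ C) ∨
          (d = 1 ∧ 1 < γ ∧ GCN.IsRegularWith μ γ C)) →
        Integrable (fun X : Fin (d + 2) → H => GCN.cPol X ^ 2) (Measure.pi fun _ => μ) ∧
          ∫ X : Fin (d + 2) → H, GCN.cPol X ^ 2 ∂(Measure.pi fun _ => μ) ≤
            K * GCN.lsError μ d ^ 2 := by
  by_cases hγ : min 2 (d : ℝ) < γ
  · obtain ⟨K, K_pos, hK⟩ := mainTheorem2_general d γ D C hγ
    exact ⟨K, K_pos, fun H _ _ _ _ _ _ μ _ hb hD h =>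
      hK H μ hb hD (h.elim And.right fun h => h.2.2.isUpperRegularWith)⟩
  · refine ⟨1, one_pos, fun _ _ _ _ _ _ _ _ _ _ _ h => (hγ ?_).elim⟩
    rcases h with ⟨two_lt, -⟩ | ⟨rfl, one_lt, -⟩
    · exact min_lt_of_left_lt two_lt
    · exact min_lt_of_right_lt (by simpa using one_lt)
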